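/- **Setting.** Let $Sch$ be a full subcategory of the category of schemes that contains all open subschemes of each of its objects; "scheme" means object of $Sch$. The big Zariski site of a scheme $X$ is the category $Sch/X$, a covering of $Y$ being a jointly surjective family of open immersions $U_i\to Y$, and $\mathcal O_X(Y)=\Gamma(Y,\mathcal O_Y)$ is its structure sheaf. A sieve $H$ on $X$ *belongs to the site* if it contains a Zariski covering of $X$; $\mathcal C_H\subseteq Sch/X$ is the full subcategory of the elements of $H$. An *$H$-presheaf* is a presheaf of $\mathcal O_X|_{\mathcal C_H}$-modules on $\mathcal C_H$. Its sheafification $\xi_HF$ is the sheaf on $Sch/X$ whose sections over $U$ are the classes of families $(\{U_i\to U\},\{s_i\})$, where $\{U_i\to U\}$ is a covering with all $U_i\in\mathcal C_H$, the $s_i$ are sections of $F^s$ over $U_i$ ($F^s$ is $F$ with locally equal sections identified) that agree on the overlaps, and two families are equivalent if they agree on the common refinement. For $f:Y\to X$, the sieve $f^*H$ consists of the $g$ with $fg\in H$, and $(f^*F)(Z\xrightarrow{g}Y)=F(Z\xrightarrow{fg}X)$; the sheaves $\xi_{f^*H}f^*F$ and $f^*\xi_HF$ are identified via $[\{U_i\to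 U\},\{s_i\}]\leftrightarrow[\{U_i\to U\},\{s_i\}]$. A *standard vector bundle* on $X$ is a pair $(H,E)$, where $H$ is a sieve on $X$ belonging to the site and $E$ is an $H$-presheaf such that for every $Y\xrightarrow{f} X$ in $\mathcal C_H$ there is an $n\ge 0$ (the rank at $Y$, part of the data of $E$) with $E(Y)=\mathcal O_Y(Y)^n$ and such that the map $\mathcal O_Y^n\to f^*E$ induced by the standard basis is an isomorphism of presheaves on $Sch/Y$. A morphism $(H,E)\to(K,F)$ is a morphism of sheaves of modules $\xi_HE\to\xi_KF$. This gives the category $\mathbf{V}(X)$. The zero bundle $0$ is the bundle of constant rank $0$ on the largest sieve on $X$. The direct sum $E\oplus F$ of $(H,E)$ and $(K,F)$ is the standard vector bundle on the sieve $H\cap K$ whose rank at $Y$ is the sum of the ranks of $E$ and $F$ and whose restriction maps are $E(g)\oplus F(g)$ under the identification $A^{r+s}= A^r\oplus A^s$, $(a_1,\dots,a_{r+s})\mapsto((a_1,\dots,a_r),(a_{r+1},\dots,a_{r+s}))$. On morphisms, $\gamma\oplus\delta$ is the map that corresponds to the direct sum of the sheaf maps $\gamma$, $\delta$ under the induced isomorphisms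 $\xi_{H\cap K}(E\oplus F)\cong\xi_HE\oplus\xi_KF$. The pullback functor $f^*:\mathbf V(X)\to\mathbf V(Y)$ along $f:Y\to X$ sends $(H,E)$ to $(f^*H,f^*E)$ and $\alpha:\xi_HE\to\xi_KF$ to $f^*\alpha:\xi_{f^*H}f^*E=f^*\xi_HE\to f^*\xi_KF=\xi_{f^*K}f^*F$. **Theorem 3.5.** Let $X$ be a scheme. 1. The direct sum is strictly associative: the functors $\oplus\circ(\oplus\times 1)$ and $\oplus\circ(1\times\oplus)$ from $\mathbf V(X)\times\mathbf V(X)\times\mathbf V(X)$ to $\mathbf V(X)$ are equal (on objects and on morphisms, not only naturally isomorphic). 2. The zero bundle is a strict identity for $\oplus$: for every $E\in\mathbf V(X)$, $0\oplus E=E\oplus 0=E$ (equalities), and for every morphism $\gamma:E\to F$ in $\mathbf V(X)$, $1_0\oplus\gamma=\gamma\oplus 1_0=\gamma$. 3. For every map of schemes $f:Y\to X$, $f^*0=0$, and the functors $f^*\circ\oplus$ and $\oplus\circ(f^*\times f^*)$ from $\mathbf V(X)\times\mathbf V(X)$ to $\mathbf V(Y)$ are equal. -/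

import Mathlib

open CategoryTheory Opposite AlgebraicGeometry

universe u

namespace StdVB

universe w' w v u₁

section Generic

variable {D : Type u₁} [Category.{v} D] {R₀ : Dᵒᵖ ⥤ RingCat.{w}}

/-- The presheaf of modules with given modules and given semilinear restriction maps. -/
noncomputable def mkPresheaf (M : ∀ A : Dᵒᵖ, ModuleCat.{w'} (R₀.obj A))
    (res : ∀ {A B : Dᵒᵖ} (f : A ⟶ B), M A →ₛₗ[(R₀.map f).hom] M B)
    (res_id : ∀ (A : Dᵒᵖ) (x : M A), res (𝟙 A) x = x)
    (res_comp : ∀ {A B B' : Dᵒᵖ} (f : A ⟶ B) (g : B ⟶ B') (x : M A),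
      res (f ≫ g) x = res g (res f x)) :
    PresheafOfModules.{w'} R₀ where
  obj A := M A
  map {A B} f := ModuleCat.ofHom
      (Y := (ModuleCat.restrictScalars (R₀.map f).hom).obj (M B))
    { toFun := fun x => res f x
      map_add' := (res f).map_add
      map_smul' := (res f).map_smulₛₗ }
  map_id A := by ext x; exact res_id A x
  map_comp f g := by ext x; exact res_comp f g x

/-- Morphism of presheaves of modules from linear maps commuting with restriction. -/
def mkHom {F G : PresheafOfModules.{w'} R₀} (φ : ∀ A : Dᵒᵖ, F.obj A →ₗ[R₀.obj A] G.obj A)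
    (nat : ∀ {A B : Dᵒᵖ} (f : A ⟶ B) (x : F.obj A), φ B (F.map f x) = G.map f (φ A x)) :
    F ⟶ G where
  app A := ModuleCat.ofHom (φ A)
  naturality f := by ext x; exact nat f x

theorem isIso_of_bijective {F G : PresheafOfModules.{w'} R₀} (φ : F ⟶ G)
    (h : ∀ A, Function.Bijective (φ.app A)) : IsIso φ := by
  let e : F ≅ G := PresheafOfModules.isoMk
    (fun A => (LinearEquiv.ofBijective (φ.app A).hom (h A)).toModuleIso)
    (fun A B f => by ext x; exact PresheafOfModules.naturality_apply φ f x)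
  have : e.hom = φ := by ext A x; rfl
  rw [← this]; infer_instance

theorem map_id_apply (F : PresheafOfModules.{w'} R₀) (A : Dᵒᵖ) (x : F.obj A) :
    F.map (𝟙 A) x = x := by
  rw [F.map_id]; rfl

/-- The presheaf direct sum `F ⊞ G`, with `(F ⊞ G)(A) = F(A) × G(A)`. -/
noncomputable def presheafSum (F G : PresheafOfModules.{w'} R₀) : PresheafOfModules.{w'} R₀ :=
  mkPresheaf (fun A => ModuleCat.of _ (F.obj A × G.obj A))
    (fun f => 
      { toFun := fun x => (F.map f x.1, G.map f x.2)
        map_add' := fun _ _ => Prod.ext (map_add (F.map f).hom _ _) (map_add (G.map f).hom _ _)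
        map_smul' := fun r x => Prod.ext (F.map_smul f r x.1) (G.map_smul f r x.2) })
    (fun A x => Prod.ext (map_id_apply F A x.1) (map_id_apply G A x.2))
    (fun f g x => Prod.ext (F.map_comp_apply f g x.1) (G.map_comp_apply f g x.2))

/-- The direct sum of two maps of presheaves, computed objectwise. -/
noncomputable def presheafSumMap {F G F' G' : PresheafOfModules.{w'} R₀} (γ : F ⟶ F') (δ : G ⟶ G') :
    presheafSum F G ⟶ presheafSum F' G' :=
  mkHom (F := presheafSum F G) (G := presheafSum F' G')
    (fun A => LinearMap.prodMap (γ.app A).hom (δ.app A).hom)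
    (fun f x => Prod.ext (PresheafOfModules.naturality_apply γ f x.1)
      (PresheafOfModules.naturality_apply δ f x.2))

/-- The map into a presheaf direct sum with given components. -/
noncomputable def presheafSumLift {F G K : PresheafOfModules.{w'} R₀} (γ : K ⟶ F) (δ : K ⟶ G) :
    K ⟶ presheafSum F G :=
  mkHom (F := K) (G := presheafSum F G)
    (fun A => LinearMap.prod (γ.app A).hom (δ.app A).hom)
    (fun f x => Prod.ext (PresheafOfModules.naturality_apply γ f x)
      (PresheafOfModules.naturality_apply δ f x))

end Generic

section Block

variable {A B : Type*} [Ring A] [Ring B] {ρ : A →+* B} {r s r' s' : ℕ}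

/-- The block diagonal semilinear map: `α` on the first `r` coordinates and `β` on the last `s`. -/
def blockSum (α : (Fin r → A) →ₛₗ[ρ] (Fin r' → B)) (β : (Fin s → A) →ₛₗ[ρ] (Fin s' → B)) :
    (Fin (r + s) → A) →ₛₗ[ρ] (Fin (r' + s') → B) where
  toFun a := Fin.append (α fun i => a (Fin.castAdd s i)) (β fun j => a (Fin.natAdd r j))
  map_add' a b := by
    funext k
    refine Fin.addCases (fun i => ?_) (fun j => ?_) k
    · simp only [Pi.add_apply, Fin.append_left]
      exact congrFun (map_add α _ _) i
    · simp only [Pi.add_apply, Fin.append_right]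
      exact congrFun (map_add β _ _) j
  map_smul' c a := by
    funext k
    refine Fin.addCases (fun i => ?_) (fun j => ?_) k
    · simp only [Pi.smul_apply, Fin.append_left]
      exact congrFun (α.map_smulₛₗ c _) i
    · simp only [Pi.smul_apply, Fin.append_right]
      exact congrFun (β.map_smulₛₗ c _) j

theorem blockSum_left (α : (Fin r → A) →ₛₗ[ρ] (Fin r' → B)) (β : (Fin s → A) →ₛₗ[ρ] (Fin s' → B))
    (a : Fin (r + s) → A) :
    (fun i => blockSum α β a (Fin.castAdd s' i)) = α fun i => a (Fin.castAdd s i) :=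
  funext fun i => Fin.append_left _ _ i

theorem blockSum_right (α : (Fin r → A) →ₛₗ[ρ] (Fin r' → B)) (β : (Fin s → A) →ₛₗ[ρ] (Fin s' → B))
    (a : Fin (r + s) → A) :
    (fun j => blockSum α β a (Fin.natAdd r' j)) = β fun j => a (Fin.natAdd r j) :=
  funext fun j => Fin.append_right _ _ j

theorem blockSum_eq {A : Type*} {n m : ℕ} {a b : Fin (n + m) → A}
    (h₁ : (fun i => a (Fin.castAdd m i)) = fun i => b (Fin.castAdd m i))
    (h₂ : (fun j => a (Fin.natAdd n j)) = fun j => b (Fin.natAdd n j)) : a = b :=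
  funext fun k => Fin.addCases (fun i => congrFun h₁ i) (fun j => congrFun h₂ j) k

theorem blockSum_bijective (α : (Fin r → A) →ₛₗ[ρ] (Fin r' → B))
    (β : (Fin s → A) →ₛₗ[ρ] (Fin s' → B))
    (hα : Function.Bijective fun c : Fin r → B => ∑ i, c i • α (Pi.single i 1))
    (hβ : Function.Bijective fun c : Fin s → B => ∑ i, c i • β (Pi.single i 1)) :
    Function.Bijective fun c : Fin (r + s) → B => ∑ i, c i • blockSum α β (Pi.single i 1) := by
  have key := ((Fin.appendEquiv (α := B) r' s').bijective.comp (hα.prodMap hβ)).comp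
    (Fin.appendEquiv (α := B) r s).symm.bijective
  convert key using 1
  have h0 : ∀ (i : Fin r), (fun k => (Pi.single (Fin.castAdd s i) (1 : A) : Fin (r + s) → A)
      (Fin.castAdd s k)) = Pi.single i 1 := by
    intro i; funext k; simp [Pi.single_apply]
  have h1 : ∀ (i : Fin r), (fun k => (Pi.single (Fin.castAdd s i) (1 : A) : Fin (r + s) → A)
      (Fin.natAdd r k)) = 0 := by
    intro i; funext k
    rw [Pi.single_apply, if_neg]; · rfl
    intro h; have := congrArg Fin.val h; simp at this; omega
  have h2 : ∀ (j : Fin s), (fun k => (Pi.single (Fin.natAdd r j) (1 : A) : Fin (r + s) → A)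
      (Fin.natAdd r k)) = Pi.single j 1 := by
    intro i; funext k; simp [Pi.single_apply]
  have h3 : ∀ (j : Fin s), (fun k => (Pi.single (Fin.natAdd r j) (1 : A) : Fin (r + s) → A)
      (Fin.castAdd s k)) = 0 := by
    intro i; funext k
    rw [Pi.single_apply, if_neg]; · rfl
    intro h; have := congrArg Fin.val h; simp at this; omega
  funext c
  refine blockSum_eq ?_ ?_
  · funext i
    simp only [Function.comp, Finset.sum_apply, Pi.smul_apply, Fin.sum_univ_add]
    simp [Fin.appendEquiv, blockSum, h0, h3, Finset.sum_apply]
  · funext i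
    simp only [Function.comp, Finset.sum_apply, Pi.smul_apply, Fin.sum_univ_add]
    simp [Fin.appendEquiv, blockSum, h1, h2, Finset.sum_apply]

end Block

section Site

variable {C : Type u₁} [Category.{v} C] (J : GrothendieckTopology C) (R : Cᵒᵖ ⥤ RingCat.{w})

/-- The category `C_H` of a sieve `H` on `X`: the full subcategory of `C/X` on the elements of `H`. -/
abbrev SieveCat {X : C} (H : Sieve X) := H.arrows.category

/-- The structure presheaf restricted to `C_H`: the value at `V → X` is `R(V)`. -/
abbrev ringOn {X : C} (H : Sieve X) : (SieveCat H)ᵒᵖ ⥤ RingCat.{w} :=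
  (ObjectProperty.ι _ ⋙ Over.forget X).op ⋙ R

/-- The structure presheaf on the big site `C/X`: the value at `V → X` is `R(V)`. -/
abbrev ringOver (X : C) : (Over X)ᵒᵖ ⥤ RingCat.{w} := (Over.forget X).op ⋙ R

/-- `H`-presheaves: presheaves of modules on `C_H` over the structure presheaf. -/
abbrev HPresheaf {X : C} (H : Sieve X) := PresheafOfModules.{w'} (ringOn R H)

variable {R} {X : C} {H : Sieve X}

/-- The submodule of the sections in `F(Y)` whose pullbacks to some covering of `Y` vanish. -/
def locallyZero (F : HPresheaf.{w'} R H) (Y : (SieveCat H)ᵒᵖ) :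
    Submodule ((ringOn R H).obj Y) (F.obj Y) where
  carrier := {s | ∃ S ∈ J Y.unop.obj.left, ∀ ⦃Z : SieveCat H⦄ (g : Z ⟶ Y.unop),
    S g.hom.left → F.map g.op s = 0}
  zero_mem' := ⟨⊤, J.top_mem _, fun Z g _ => map_zero (F.map g.op).hom⟩
  add_mem' := by
    rintro a b ⟨S, hS, ha⟩ ⟨T, hT, hb⟩
    refine ⟨S ⊓ T, J.intersection_covering hS hT, fun Z g hg => ?_⟩
    refine (map_add (F.map g.op).hom a b).trans ?_
    erw [ha g hg.1, hb g hg.2]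
    exact add_zero _
  smul_mem' := by
    rintro r a ⟨S, hS, ha⟩
    refine ⟨S, hS, fun Z g hg => ?_⟩
    rw [F.map_smul, ha g hg, smul_zero]

theorem locallyZero_map (F : HPresheaf.{w'} R H) {Y Z : (SieveCat H)ᵒᵖ} (g : Y ⟶ Z) (s : F.obj Y)
    (hs : s ∈ locallyZero J F Y) : (F.map g s : F.obj Z) ∈ locallyZero J F Z := by
  obtain ⟨S, hS, h⟩ := hs
  refine ⟨S.pullback g.unop.hom.left, J.pullback_stable _ hS, fun W k hk => ?_⟩
  rw [← F.map_comp_apply]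
  exact h (k ≫ g.unop) (by simpa using hk)

/-- The separated `H`-presheaf `F^s`: sections of `F`, two of them being identified when their
pullbacks to some covering coincide. -/
noncomputable def sep (F : HPresheaf.{w'} R H) : HPresheaf.{w'} R H :=
  mkPresheaf (R₀ := ringOn R H) (fun Y => ModuleCat.of _ (F.obj Y ⧸ locallyZero J F Y))
    (fun {Y Z} g => Submodule.mapQ (locallyZero J F Y) (locallyZero J F Z) (F.restrictₛₗ g)
      (fun s hs => locallyZero_map J F g s hs))
    (fun Y x => by
      obtain ⟨x, rfl⟩ := Submodule.Quotient.mk_surjective _ x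
      exact congrArg Submodule.Quotient.mk (map_id_apply F Y x))
    (fun f g x => by
      obtain ⟨x, rfl⟩ := Submodule.Quotient.mk_surjective _ x
      exact congrArg Submodule.Quotient.mk (F.map_comp_apply f g x))

/-- `F^s` is separated. -/
theorem sep_separated (F : HPresheaf.{w'} R H) {Y : SieveCat H} (S : Sieve Y.obj.left)
    (hS : S ∈ J Y.obj.left) (x : (sep J F).obj (op Y))
    (h : ∀ ⦃Z : SieveCat H⦄ (g : Z ⟶ Y), S g.hom.left → (sep J F).map g.op x = 0) : x = 0 := by
  obtain ⟨x, rfl⟩ := Submodule.Quotient.mk_surjective _ x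
  refine (Submodule.Quotient.mk_eq_zero _).2 ?_
  have key : ∀ ⦃Z : SieveCat H⦄ (g : Z ⟶ Y), S g.hom.left →
      ∃ T ∈ J Z.obj.left, ∀ ⦃W : SieveCat H⦄ (k : W ⟶ Z), T k.hom.left →
        F.map (k ≫ g).op x = 0 := by
    intro Z g hg
    obtain ⟨T, hT, hT'⟩ := (Submodule.Quotient.mk_eq_zero _).1 (h g hg)
    refine ⟨T, hT, fun W k hk => ?_⟩
    have := hT' k hk
    erw [← F.map_comp_apply] at this
    exact this
  let B : Sieve Y.obj.left :=
    { arrows := fun V f => ∀ ⦃W : SieveCat H⦄ (k : W ⟶ Y), ∀ l : W.obj.left ⟶ V,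
        l ≫ f = k.hom.left → F.map k.op x = 0
      downward_closed := by
        intro V V' f hf g W k l hl
        exact hf k (l ≫ g) (by simpa using hl) }
  refine ⟨B, J.transitive hS B fun V f hf => ?_, fun Z g hg => hg g (𝟙 _) (by simp)⟩
  let Z : SieveCat H := ⟨Over.mk (f ≫ Y.obj.hom), H.downward_closed Y.property f⟩
  let g : Z ⟶ Y := ObjectProperty.homMk (Over.homMk f (by simp [Z]))
  obtain ⟨T, hT, hT'⟩ := key g hf
  refine J.superset_covering (fun V' f' hf' => ?_) hT
  intro W k l hl
  let k' : W ⟶ Z := ObjectProperty.homMk (Over.homMk (l ≫ f') (by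
    have := Over.w k.hom
    simp [Z, ← this, ← hl]))
  have h1 : k' ≫ g = k := by
    ext; simp [k', g, ← hl]
  rw [← h1]
  exact hT' k' (T.downward_closed hf' l)

/-- A representative of a section over `U → X` of the sheafification of an `H`-presheaf `F`:
a covering of `U` (given by the covering sieve `cov` that it generates) all of whose members lie in
`C_H`, together with sections of `F^s` on its members that are compatible with pullback. A family on
a covering that agrees on the fibre products is the same thing as a compatible family on the
generated sieve. -/
structure LocalSection (F : HPresheaf.{w'} R H) (U : Over X) where
  cov : Sieve U.left
  mem : cov ∈ J U.left
  le : cov ≤ H.pullback U.hom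
  sec : ∀ ⦃V : SieveCat H⦄ (f : V.obj ⟶ U), cov f.left → (sep J F).obj (op V)
  compat : ∀ ⦃V W : SieveCat H⦄ (f : V.obj ⟶ U) (hf : cov f.left) (g : W ⟶ V),
    (sep J F).map g.op (sec f hf) = sec (g.hom ≫ f) (cov.downward_closed hf g.hom.left)

namespace LocalSection

variable {J} {F : HPresheaf.{w'} R H} {U : Over X}

/-- Two representatives are equivalent if they agree on the common refinement of their coverings. -/
instance setoid : Setoid (LocalSection J F U) where
  r a b := ∀ ⦃V : SieveCat H⦄ (f : V.obj ⟶ U) (ha : a.cov f.left) (hb : b.cov f.left),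
    a.sec f ha = b.sec f hb
  iseqv :=
    { refl := fun a V f _ _ => rfl
      symm := fun h V f ha hb => (h f hb ha).symm
      trans := by
        intro a b c hab hbc V f ha hc
        rw [← sub_eq_zero]
        refine sep_separated J F (b.cov.pullback f.left) (J.pullback_stable _ b.mem) _ ?_
        intro Z g hg
        refine (map_sub ((sep J F).map g.op).hom _ _).trans (sub_eq_zero.2 ?_)
        refine (a.compat f ha g).trans (Eq.trans ?_ (c.compat f hc g).symm)
        exact (hab (g.hom ≫ f) _ (by simpa using hg)).trans (hbc (g.hom ≫ f) _ _) }

theorem equiv_def {a b : LocalSection J F U} : a ≈ b ↔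
    ∀ ⦃V : SieveCat H⦄ (f : V.obj ⟶ U) (ha : a.cov f.left) (hb : b.cov f.left),
      a.sec f ha = b.sec f hb := Iff.rfl

/-- The zero section; it needs that `H` belongs to the site. -/
noncomputable def zero (hH : H ∈ J X) : LocalSection J F U where
  cov := H.pullback U.hom
  mem := J.pullback_stable _ hH
  le := le_rfl
  sec _ _ _ := 0
  compat _ _ _ _ g := map_zero ((sep J F).map g.op).hom

/-- The sum, on the common refinement. -/
noncomputable def add (a b : LocalSection J F U) : LocalSection J F U where
  cov := a.cov ⊓ b.cov
  mem := J.intersection_covering a.mem b.mem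
  le := inf_le_left.trans a.le
  sec _ f hf := a.sec f hf.1 + b.sec f hf.2
  compat _ _ f hf g := (map_add ((sep J F).map g.op).hom _ _).trans
    (congrArg₂ (· + ·) (a.compat f hf.1 g) (b.compat f hf.2 g))

/-- The negative. -/
noncomputable def neg (a : LocalSection J F U) : LocalSection J F U where
  cov := a.cov
  mem := a.mem
  le := a.le
  sec _ f hf := - a.sec f hf
  compat _ _ f hf g := (map_neg ((sep J F).map g.op).hom _).trans
    (congrArg (- ·) (a.compat f hf g))

/-- The restriction of a function on `U` along `V ⟶ U`. -/
def scalar {V : SieveCat H} (f : V.obj ⟶ U) : R.obj (op U.left) →+* (ringOn R H).obj (op V) :=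
  (R.map f.left.op).hom

theorem scalar_map (r : R.obj (op U.left)) {V W : SieveCat H} (f : V.obj ⟶ U) (g : W ⟶ V) :
    (ringOn R H).map g.op (scalar f r) = scalar (g.hom ≫ f) r := by
  simp only [scalar, Over.comp_left, op_comp, R.map_comp]
  rfl

/-- Multiplication by a function on `U`. -/
noncomputable def smul (r : R.obj (op U.left)) (a : LocalSection J F U) : LocalSection J F U where
  cov := a.cov
  mem := a.mem
  le := a.le
  sec _ f hf := scalar f r • a.sec f hf
  compat _ _ f hf g := ((sep J F).map_smul g.op _ _).trans
    (congrArg₂ (· • ·) (scalar_map r f g) (a.compat f hf g))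

/-- The restriction along `h : U' ⟶ U`: the same family on the pulled back covering. -/
noncomputable def res {U' : Over X} (h : U' ⟶ U) (a : LocalSection J F U) : LocalSection J F U' where
  cov := a.cov.pullback h.left
  mem := J.pullback_stable _ a.mem
  le := fun V f hf => by simpa using a.le _ hf
  sec _ f hf := a.sec (f ≫ h) (by simpa using hf)
  compat _ _ f hf g := by
    refine (a.compat (f ≫ h) _ g).trans ?_
    congr 1
    simp

end LocalSection

/-- The sections over `U` of the sheafification of the `H`-presheaf `F`, where `H` belongs to the
site. -/
def SheafifySection (_hH : H ∈ J X) (F : HPresheaf.{w'} R H) (U : Over X) :=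
  Quotient (LocalSection.setoid (J := J) (F := F) (U := U))

namespace SheafifySection

open LocalSection

variable {J} {hH : H ∈ J X} {F : HPresheaf.{w'} R H} {U : Over X}

noncomputable instance : Zero (SheafifySection J hH F U) := ⟨⟦LocalSection.zero hH⟧⟩

noncomputable instance : Add (SheafifySection J hH F U) :=
  ⟨Quotient.map₂ LocalSection.add fun _ _ h _ _ k _ f ha hb =>
    congrArg₂ (· + ·) (h f ha.1 hb.1) (k f ha.2 hb.2)⟩

noncomputable instance : Neg (SheafifySection J hH F U) :=
  ⟨Quotient.map LocalSection.neg fun _ _ h _ f ha hb => congrArg (- ·) (h f ha hb)⟩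

noncomputable instance : SMul (R.obj (op U.left)) (SheafifySection J hH F U) :=
  ⟨fun r => Quotient.map (LocalSection.smul r) fun _ _ h _ f ha hb =>
    congrArg (_ • ·) (h f ha hb)⟩

noncomputable instance : AddCommGroup (SheafifySection J hH F U) where
  add_assoc := by
    rintro ⟨a⟩ ⟨b⟩ ⟨c⟩
    exact Quotient.sound fun V f _ _ => add_assoc _ _ _
  zero_add := by
    rintro ⟨a⟩
    exact Quotient.sound fun V f _ _ => zero_add _
  add_zero := by
    rintro ⟨a⟩
    exact Quotient.sound fun V f _ _ => add_zero _
  add_comm := by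
    rintro ⟨a⟩ ⟨b⟩
    exact Quotient.sound fun V f _ _ => add_comm _ _
  neg_add_cancel := by
    rintro ⟨a⟩
    exact Quotient.sound fun V f _ _ => neg_add_cancel _
  nsmul := nsmulRec
  zsmul := zsmulRec

noncomputable instance : Module (R.obj (op U.left)) (SheafifySection J hH F U) where
  one_smul := by
    rintro ⟨a⟩
    exact Quotient.sound fun V f _ _ =>
      (congrArg (· • a.sec f _) (map_one (scalar f))).trans (one_smul _ _)
  mul_smul := by
    rintro r r' ⟨a⟩
    exact Quotient.sound fun V f _ _ =>
      (congrArg (· • a.sec f _) (map_mul (scalar f) r r')).trans (mul_smul _ _ _)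
  smul_zero := by
    intro r
    exact Quotient.sound fun V f _ _ => smul_zero _
  smul_add := by
    rintro r ⟨a⟩ ⟨b⟩
    exact Quotient.sound fun V f _ _ => smul_add _ _ _
  add_smul := by
    rintro r r' ⟨a⟩
    exact Quotient.sound fun V f _ _ =>
      (congrArg (· • a.sec f _) (map_add (scalar f) r r')).trans (add_smul _ _ _)
  zero_smul := by
    rintro ⟨a⟩
    exact Quotient.sound fun V f _ _ =>
      (congrArg (· • a.sec f _) (map_zero (scalar f))).trans (zero_smul _ _)

/-- Restriction of sections of the sheafification. -/
noncomputable def res {U' : Over X} (h : U' ⟶ U) :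
    SheafifySection J hH F U →ₛₗ[(R.map h.left.op).hom] SheafifySection J hH F U' where
  toFun := Quotient.map (LocalSection.res h) fun _ _ k _ f ha hb => k (f ≫ h) _ _
  map_add' := by
    rintro ⟨a⟩ ⟨b⟩
    exact Quotient.sound fun V f _ _ => rfl
  map_smul' := by
    rintro r ⟨a⟩
    refine Quotient.sound fun V f _ _ => ?_
    refine congrArg (· • a.sec (f ≫ h) _) ?_
    exact congrArg (fun k => (R.map k).hom r) (by simp : (f ≫ h).left.op = h.left.op ≫ f.left.op)
      |>.trans (by rw [R.map_comp]; rfl)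

end SheafifySection

/-- The sheafification `ξ_H F`, a presheaf of modules (in fact a sheaf) on the big site `C/X`. -/
noncomputable def sheafify (hH : H ∈ J X) (F : HPresheaf.{w'} R H) :
    PresheafOfModules.{max u₁ v w'} (ringOver R X) :=
  mkPresheaf (R₀ := ringOver R X) (fun U => ModuleCat.of (R.obj (op U.unop.left)) (SheafifySection J hH F U.unop))
    (fun h => SheafifySection.res h.unop)
    (by
      rintro U ⟨a⟩
      refine Quotient.sound fun V f ha hb => ?_
      change a.sec (f ≫ 𝟙 _) _ = _
      congr 1
      simp)
    (by
      rintro U U' U'' h k ⟨a⟩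
      refine Quotient.sound fun V f ha hb => ?_
      change a.sec (f ≫ k.unop ≫ h.unop) _ = a.sec ((f ≫ k.unop) ≫ h.unop) _
      congr 1
      simp)

section Compare

variable {K : Sieve X}

/-- The inclusion `C_K ⊆ C_H` for `K ⊆ H`. -/
abbrev incl (hKH : K ≤ H) : SieveCat K ⥤ SieveCat H :=
  ObjectProperty.ιOfLE (fun _ hY => hKH _ hY)

/-- The restriction `F|_K` of an `H`-presheaf to `K ⊆ H`. -/
noncomputable def restrictPresheaf (hKH : K ≤ H) (F : HPresheaf.{w'} R H) : HPresheaf.{w'} R K :=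
  mkPresheaf (R₀ := ringOn R K) (fun Y => F.obj (op ((incl hKH).obj Y.unop)))
    (fun g => F.restrictₛₗ ((incl hKH).map g.unop).op)
    (fun _ x => map_id_apply F _ x)
    (fun g h x => F.map_comp_apply ((incl hKH).map g.unop).op ((incl hKH).map h.unop).op x)

theorem locallyZero_compare (hKH : K ≤ H) {G : HPresheaf.{w'} R K} {F : HPresheaf.{w'} R H}
    (φ : G ⟶ restrictPresheaf hKH F) (Y : SieveCat K) (s : G.obj (op Y)) (hs : s ∈ locallyZero J G (op Y)) :
    (φ.app (op Y) s : F.obj (op ((incl hKH).obj Y))) ∈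
      locallyZero J F (op ((incl hKH).obj Y)) := by
  obtain ⟨S, hS, h⟩ := hs
  refine ⟨S, hS, fun Z g hg => ?_⟩
  let Z' : SieveCat K := ⟨Z.obj, by
    have := K.downward_closed Y.property g.hom.left
    have hw := Over.w g.hom
    exact hw ▸ this⟩
  let g' : Z' ⟶ Y := ObjectProperty.homMk g.hom
  refine (PresheafOfModules.naturality_apply φ g'.op s).symm.trans ?_
  rw [h g' hg]
  exact map_zero (φ.app (op Z')).hom

/-- The map `G^s → F^s|_K` induced by a map `G → F|_K`. -/
noncomputable def sepMap (hKH : K ≤ H) {G : HPresheaf.{w'} R K} {F : HPresheaf.{w'} R H}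
    (φ : G ⟶ restrictPresheaf hKH F) : sep J G ⟶ restrictPresheaf hKH (sep J F) :=
  mkHom (F := sep J G) (G := restrictPresheaf hKH (sep J F))
    (fun Y => Submodule.mapQ (locallyZero J G Y) (locallyZero J F (op ((incl hKH).obj Y.unop)))
      (φ.app Y).hom (fun s hs => locallyZero_compare J hKH φ Y.unop s hs))
    (fun g x => by
      obtain ⟨x, rfl⟩ := Submodule.Quotient.mk_surjective _ x
      exact congrArg Submodule.Quotient.mk (PresheafOfModules.naturality_apply φ g x))

variable {J} in
theorem LocalSection.mem_of_cov {G : HPresheaf.{w'} R K} {U : Over X} (a : LocalSection J G U)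
    {V : Over X} (f : V ⟶ U) (hf : a.cov f.left) : K V.hom := by
  have := a.le _ hf
  have hw := Over.w f
  exact hw ▸ this

variable {J} in
/-- The map on representatives induced by a map `G → F|_K`, where `K ⊆ H`. -/
noncomputable def LocalSection.compare (hKH : K ≤ H) {G : HPresheaf.{w'} R K}
    {F : HPresheaf.{w'} R H} (φ : G ⟶ restrictPresheaf hKH F) {U : Over X} (a : LocalSection J G U) :
    LocalSection J F U where
  cov := a.cov
  mem := a.mem
  le := a.le.trans (fun _ _ h => hKH _ h)
  sec V f hf := ((sepMap J hKH φ).app (op ⟨V.obj, a.mem_of_cov f hf⟩)).hom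
    (a.sec (V := ⟨V.obj, a.mem_of_cov f hf⟩) f hf)
  compat V W f hf g := by
    let V' : SieveCat K := ⟨V.obj, a.mem_of_cov f hf⟩
    let W' : SieveCat K := ⟨W.obj, a.mem_of_cov (g.hom ≫ f) (a.cov.downward_closed hf g.hom.left)⟩
    let g' : W' ⟶ V' := ObjectProperty.homMk g.hom
    refine (PresheafOfModules.naturality_apply (sepMap J hKH φ) g'.op _).symm.trans ?_
    exact congrArg ((sepMap J hKH φ).app (op W')).hom (a.compat (V := V') f hf g')

/-- The map `ξ_K G → ξ_H F` induced by a map `G → F|_K` with `K ⊆ H`; it sends the class of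
`({U_i → U}, {s_i})` to the class of `({U_i → U}, {φ s_i})`. For `K = H` this is the functoriality of
sheafification, and for `φ` the identity it is the comparison `ξ_K (F|_K) → ξ_H F`. -/
noncomputable def sheafifyMap (hKH : K ≤ H) (hK : K ∈ J X) (hH : H ∈ J X) {G : HPresheaf.{w'} R K}
    {F : HPresheaf.{w'} R H} (φ : G ⟶ restrictPresheaf hKH F) : sheafify J hK G ⟶ sheafify J hH F :=
  mkHom (F := sheafify J hK G) (G := sheafify J hH F)
    (fun U =>
      { toFun := _root_.Quotient.map (LocalSection.compare hKH φ) (fun a b h V f ha hb =>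
          congrArg ((sepMap J hKH φ).app (op ⟨V.obj, a.mem_of_cov f ha⟩)).hom (h (V := ⟨V.obj, _⟩) f ha hb))
        map_add' := by
          rintro ⟨a⟩ ⟨b⟩
          exact Quotient.sound fun V f _ _ => map_add ((sepMap J hKH φ).app _).hom _ _
        map_smul' := by
          rintro r ⟨a⟩
          exact Quotient.sound fun V f _ _ => map_smul ((sepMap J hKH φ).app _).hom _ _ })
    (by
      rintro U U' h ⟨a⟩
      exact Quotient.sound fun V f _ _ => rfl)

end Compare

section Pullback

variable {Y : C} (f : Y ⟶ X)

/-- The functor `f_* : C_{f^*H} ⥤ C_H` given by composition with `f : Y ⟶ X`. -/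
abbrev push (H : Sieve X) : SieveCat (H.pullback f) ⥤ SieveCat H where
  obj V := ⟨(Over.map f).obj V.obj, V.property⟩
  map g := ObjectProperty.homMk ((Over.map f).map g.hom)

/-- The pullback `f^*F` of an `H`-presheaf: the composite of `F` with `f_*`. -/
noncomputable def pullbackPresheaf (F : HPresheaf.{w'} R H) : HPresheaf.{w'} R (H.pullback f) :=
  mkPresheaf (R₀ := ringOn R (H.pullback f)) (fun V => F.obj (op ((push f H).obj V.unop)))
    (fun g => F.restrictₛₗ ((push f H).map g.unop).op)
    (fun V x => (F.congr_map_apply (congrArg Quiver.Hom.op ((push f H).map_id V.unop)) x).trans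
      (map_id_apply F _ x))
    (fun g h x => (F.congr_map_apply
      (congrArg Quiver.Hom.op ((push f H).map_comp h.unop g.unop)) x).trans
      (F.map_comp_apply ((push f H).map g.unop).op ((push f H).map h.unop).op x))

/-- The pullback of a presheaf of modules on `C/X` to `C/Y`. -/
noncomputable def pullbackOver (M : PresheafOfModules.{w'} (ringOver R X)) :
    PresheafOfModules.{w'} (ringOver R Y) :=
  mkPresheaf (R₀ := ringOver R Y) (fun V => M.obj (op ((Over.map f).obj V.unop)))
    (fun g => M.restrictₛₗ ((Over.map f).map g.unop).op)
    (fun V x => (M.congr_map_apply (congrArg Quiver.Hom.op ((Over.map f).map_id V.unop)) x).trans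
      (map_id_apply M _ x))
    (fun g h x => (M.congr_map_apply
      (congrArg Quiver.Hom.op ((Over.map f).map_comp h.unop g.unop)) x).trans
      (M.map_comp_apply ((Over.map f).map g.unop).op ((Over.map f).map h.unop).op x))

/-- The pullback of a map of presheaves of modules on `C/X`. -/
noncomputable def pullbackOverMap {M N : PresheafOfModules.{w'} (ringOver R X)} (φ : M ⟶ N) :
    pullbackOver f M ⟶ pullbackOver f N :=
  mkHom (F := pullbackOver f M) (G := pullbackOver f N)
    (fun V => (φ.app (op ((Over.map f).obj V.unop))).hom)
    (fun g x => PresheafOfModules.naturality_apply φ ((Over.map f).map g.unop).op x)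

/-- The sections of `f^*F` that vanish on some covering by objects of `C_H`. -/
def locallyZeroPull (F : HPresheaf.{w'} R H) (V : (SieveCat (H.pullback f))ᵒᵖ) :
    Submodule ((ringOn R (H.pullback f)).obj V) ((pullbackPresheaf f F).obj V) :=
  locallyZero J F (op ((push f H).obj V.unop))

theorem locallyZeroPull_eq (F : HPresheaf.{w'} R H) (V : SieveCat (H.pullback f)) :
    locallyZeroPull J f F (op V) = locallyZero J (pullbackPresheaf f F) (op V) := by
  ext s
  constructor
  · rintro ⟨S, hS, h⟩
    exact ⟨S, hS, fun Z g hg => h ((push f H).map g) hg⟩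
  · rintro ⟨S, hS, h⟩
    refine ⟨S, hS, fun Z g hg => ?_⟩
    have hw := Over.w g.hom
    let Z' : SieveCat (H.pullback f) := ⟨Over.mk (g.hom.left ≫ V.obj.hom),
      (H.pullback f).downward_closed V.property _⟩
    let g' : Z' ⟶ V := ObjectProperty.homMk (Over.homMk g.hom.left rfl)
    let i : Z ⟶ (push f H).obj Z' := ObjectProperty.homMk (Over.homMk (𝟙 _) (by
      simpa [Z'] using hw))
    have hg' : i ≫ (push f H).map g' = g := by
      ext; simp [i, g']
    rw [← hg', op_comp]
    refine (F.map_comp_apply ((push f H).map g').op i.op s).trans ?_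
    refine (congrArg (F.map i.op) (h g' hg)).trans ?_
    exact map_zero (F.map i.op).hom

/-- The identification of `f^*(F^s)` with `(f^*F)^s`. -/
noncomputable def sepPullback (F : HPresheaf.{w'} R H) :
    pullbackPresheaf f (sep J F) ⟶ sep J (pullbackPresheaf f F) :=
  mkHom (F := pullbackPresheaf f (sep J F)) (G := sep J (pullbackPresheaf f F))
    (fun V => (Submodule.quotEquivOfEq (locallyZeroPull J f F V) (locallyZero J (pullbackPresheaf f F) V)
      (locallyZeroPull_eq J f F V.unop)).toLinearMap)
    (fun g x => by
      obtain ⟨x, rfl⟩ := Submodule.Quotient.mk_surjective _ x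
      rfl)

theorem sepPullback_bijective (F : HPresheaf.{w'} R H) (V : (SieveCat (H.pullback f))ᵒᵖ) :
    Function.Bijective ((sepPullback J f F).app V).hom :=
  (Submodule.quotEquivOfEq (locallyZeroPull J f F V) (locallyZero J (pullbackPresheaf f F) V)
    (locallyZeroPull_eq J f F V.unop)).bijective

variable {J} in
/-- A representative of a section of `ξ_H F` over `U → Y → X` is a representative of a section of
`ξ_{f^*H} f^*F` over `U → Y`. -/
noncomputable def LocalSection.pullback {F : HPresheaf.{w'} R H} {U : Over Y}
    (a : LocalSection J F ((Over.map f).obj U)) : LocalSection J (pullbackPresheaf f F) U where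
  cov := a.cov
  mem := a.mem
  le V g hg := by simpa using a.le _ hg
  sec V g hg := ((sepPullback J f F).app (op V)).hom (a.sec (V := (push f H).obj V) ((Over.map f).map g) hg)
  compat V W g hg k := by
    refine (PresheafOfModules.naturality_apply (sepPullback J f F) k.op _).symm.trans (congrArg _ ?_)
    refine (a.compat (V := (push f H).obj V) ((Over.map f).map g) hg ((push f H).map k)).trans ?_
    congr 1

/-- The identification of `f^* ξ_H F` with `ξ_{f^*H} f^*F`: the class of `({U_i → U}, {s_i})` goes
to the class of `({U_i → U}, {s_i})`. -/
noncomputable def sheafifyPullbackHom (hH : H ∈ J X) (F : HPresheaf.{w'} R H) :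
    pullbackOver f (sheafify J hH F) ⟶ sheafify J (J.pullback_stable f hH) (pullbackPresheaf f F) :=
  mkHom (F := pullbackOver f (sheafify J hH F)) (G := sheafify J (J.pullback_stable f hH) (pullbackPresheaf f F))
    (fun U =>
      { toFun := Quotient.map (LocalSection.pullback f) (fun a b h V g ha hb =>
          congrArg ((sepPullback J f F).app (op V)).hom (h (V := (push f H).obj V) ((Over.map f).map g) ha hb))
        map_add' := by
          rintro ⟨a⟩ ⟨b⟩
          exact Quotient.sound fun V g _ _ => map_add ((sepPullback J f F).app _).hom _ _
        map_smul' := by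
          rintro r ⟨a⟩
          exact Quotient.sound fun V g _ _ => map_smul ((sepPullback J f F).app _).hom _ _ })
    (by
      rintro U U' h ⟨a⟩
      refine Quotient.sound fun V g _ _ => ?_
      refine congrArg ((sepPullback J f F).app (op V)).hom ?_
      change a.sec _ _ = a.sec _ _
      congr 1
      )

section Lift

variable {f} {U : Over Y} {V : SieveCat H} (g : V.obj ⟶ (Over.map f).obj U)

/-- An object of `C_H` over `f_* U` comes from an object of `C_{f^*H}` over `U`. -/
def liftObj : SieveCat (H.pullback f) :=
  ⟨Over.mk (g.left ≫ U.hom), by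
    have h := V.property
    rw [← Over.w g] at h
    simpa using h⟩

/-- The structure map of `liftObj g` over `U`. -/
def liftMap : (liftObj g).obj ⟶ U := Over.homMk g.left rfl

/-- The comparison of `V` with the image of `liftObj g` under `f_*`. -/
def liftUnit : V ⟶ (push f H).obj (liftObj g) :=
  ObjectProperty.homMk (Over.homMk (𝟙 _) (by simpa [liftObj] using Over.w g))

theorem liftUnit_comp : (liftUnit g).hom ≫ (Over.map f).map (liftMap g) = g := by
  ext; exact Category.id_comp _

end Lift

theorem sheafifyPullbackHom_bijective (hH : H ∈ J X) (F : HPresheaf.{w'} R H) (U : (Over Y)ᵒᵖ) :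
    Function.Bijective ((sheafifyPullbackHom J f hH F).app U).hom := by
  constructor
  · rintro ⟨a⟩ ⟨b⟩ hab
    refine Quotient.sound fun V g ha hb => ?_
    have h := Quotient.exact hab
    have h1 := (sepPullback_bijective J f F (op (liftObj g))).1 (h (liftMap g) ha hb)
    have ca := a.compat (V := (push f H).obj (liftObj g)) ((Over.map f).map (liftMap g)) ha
      (liftUnit g)
    have cb := b.compat (V := (push f H).obj (liftObj g)) ((Over.map f).map (liftMap g)) hb
      (liftUnit g)
    have e := liftUnit_comp g
    calc a.sec g ha = a.sec ((liftUnit g).hom ≫ (Over.map f).map (liftMap g)) (by rwa [e]) := by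
          congr 1; exact e.symm
      _ = b.sec ((liftUnit g).hom ≫ (Over.map f).map (liftMap g)) (by rwa [e]) :=
          ca.symm.trans ((congrArg ((sep J F).map (liftUnit g).op) h1).trans cb)
      _ = b.sec g hb := by congr 1
  · rintro ⟨b⟩
    let I : ∀ V : SieveCat (H.pullback f), (sep J (pullbackPresheaf f F)).obj (op V) →
        (sep J F).obj (op ((push f H).obj V)) :=
      fun V => Function.surjInv (sepPullback_bijective J f F (op V)).2
    have hI : ∀ V y, ((sepPullback J f F).app (op V)).hom (I V y) = y :=
      fun V => Function.surjInv_eq (sepPullback_bijective J f F (op V)).2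
    have hIn : ∀ {V W : SieveCat (H.pullback f)} (k : W ⟶ V) (y),
        I W ((sep J (pullbackPresheaf f F)).map k.op y) =
          (sep J F).map ((push f H).map k).op (I V y) := by
      intro V W k y
      refine (sepPullback_bijective J f F (op W)).1 ?_
      refine (hI W _).trans ?_
      refine Eq.trans ?_ (PresheafOfModules.naturality_apply (sepPullback J f F) k.op (I V y)).symm
      exact congrArg ((sep J (pullbackPresheaf f F)).map k.op) (hI V y).symm
    let a : LocalSection J F ((Over.map f).obj U.unop) :=
      { cov := b.cov
        mem := b.mem
        le := fun V g hg => by simpa using b.le _ hg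
        sec := fun V g hg => (sep J F).map (liftUnit g).op (I _ (b.sec (liftMap g) hg))
        compat := fun V W g hg k => by
          let k' : liftObj (k.hom ≫ g) ⟶ liftObj g :=
            ObjectProperty.homMk (Over.homMk k.hom.left (by simp [liftObj]))
          have e1 : k'.hom ≫ liftMap g = liftMap (k.hom ≫ g) := by
            ext; rfl
          have e2 : k ≫ liftUnit g = liftUnit (k.hom ≫ g) ≫ (push f H).map k' := by
            ext; exact (Category.comp_id _).trans (Category.id_comp _).symm
          have hb := b.compat (liftMap g) hg k'
          rw [← (sep J F).map_comp_apply, ← op_comp, e2, op_comp, (sep J F).map_comp_apply,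
            ← hIn k', hb]
          congr 3 }
    refine ⟨Quotient.mk _ a, Quotient.sound fun V g ha hb => ?_⟩
    let i : V ⟶ liftObj (H := H) (V := (push f H).obj V) ((Over.map f).map g) :=
      ObjectProperty.homMk (Over.homMk (𝟙 _) (by simp [liftObj]))
    have ei : liftUnit (V := (push f H).obj V) ((Over.map f).map g) = (push f H).map i := by
      ext; rfl
    have eg : i.hom ≫ liftMap (H := H) (V := (push f H).obj V) ((Over.map f).map g) = g := by
      ext; exact Category.id_comp _
    change ((sepPullback J f F).app (op V)).hom ((sep J F).map (liftUnit _).op (I _ (b.sec _ _))) = _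
    rw [ei, ← hIn i]
    refine (hI V _).trans ((b.compat _ _ i).trans ?_)
    congr 1

theorem isIso_sheafifyPullbackHom (hH : H ∈ J X) (F : HPresheaf.{w'} R H) :
    IsIso (sheafifyPullbackHom J f hH F) :=
  isIso_of_bijective _ (fun U => sheafifyPullbackHom_bijective J f hH F U)

end Pullback

theorem isIso_presheafSumLift_sheafifyMap {K : Sieve X} (hHK : H ⊓ K ∈ J X) (hH : H ∈ J X) (hK : K ∈ J X)
    {P : HPresheaf.{w'} R (H ⊓ K)} {F : HPresheaf.{w'} R H} {G : HPresheaf.{w'} R K}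
    (φ : P ⟶ restrictPresheaf inf_le_left F) (ψ : P ⟶ restrictPresheaf inf_le_right G)
    (h : ∀ Y, Function.Bijective fun s : P.obj Y => ((φ.app Y).hom s, (ψ.app Y).hom s)) :
    IsIso (presheafSumLift (sheafifyMap J inf_le_left hHK hH φ) (sheafifyMap J inf_le_right hHK hK ψ)) := by
  have hb : ∀ Y : SieveCat (H ⊓ K), Function.Bijective fun s : (sep J P).obj (op Y) =>
      (((sepMap J inf_le_left φ).app (op Y)).hom s, ((sepMap J inf_le_right ψ).app (op Y)).hom s) := by
    intro Y
    constructor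
    · intro s t hst
      rw [← sub_eq_zero]
      have e1 : ((sepMap J inf_le_left φ).app (op Y)).hom (s - t) = 0 :=
        (map_sub _ s t).trans (sub_eq_zero.2 (Prod.ext_iff.1 hst).1)
      have e2 : ((sepMap J inf_le_right ψ).app (op Y)).hom (s - t) = 0 :=
        (map_sub _ s t).trans (sub_eq_zero.2 (Prod.ext_iff.1 hst).2)
      generalize s - t = x at e1 e2
      obtain ⟨x, rfl⟩ := Submodule.Quotient.mk_surjective _ x
      refine (Submodule.Quotient.mk_eq_zero _).2 ?_
      obtain ⟨S, hS, h1⟩ := (Submodule.Quotient.mk_eq_zero _).1 e1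
      obtain ⟨T, hT, h2⟩ := (Submodule.Quotient.mk_eq_zero _).1 e2
      refine ⟨S ⊓ T, J.intersection_covering hS hT, fun Z g hg => (h (op Z)).1 ?_⟩
      refine Prod.ext ?_ ?_
      · exact ((PresheafOfModules.naturality_apply φ g.op x).trans
          (h1 ((incl inf_le_left).map g) hg.1)).trans (map_zero (φ.app (op Z)).hom).symm
      · exact ((PresheafOfModules.naturality_apply ψ g.op x).trans
          (h2 ((incl inf_le_right).map g) hg.2)).trans (map_zero (ψ.app (op Z)).hom).symm
    · rintro ⟨x, y⟩
      obtain ⟨x, rfl⟩ := Submodule.Quotient.mk_surjective _ x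
      obtain ⟨y, rfl⟩ := Submodule.Quotient.mk_surjective _ y
      obtain ⟨s, hs⟩ := (h (op Y)).2 (x, y)
      exact ⟨Submodule.Quotient.mk s, Prod.ext
        (congrArg Submodule.Quotient.mk (Prod.ext_iff.1 hs).1)
        (congrArg Submodule.Quotient.mk (Prod.ext_iff.1 hs).2)⟩
  refine isIso_of_bijective _ fun U => ⟨?_, ?_⟩
  · rintro ⟨a⟩ ⟨b⟩ hab
    have h1 := Quotient.exact (Prod.ext_iff.1 hab).1
    have h2 := Quotient.exact (Prod.ext_iff.1 hab).2
    refine Quotient.sound fun V f ha hb' => (hb V).1 (Prod.ext ?_ ?_)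
    · exact h1 (V := (incl inf_le_left).obj V) f ha hb'
    · exact h2 (V := (incl inf_le_right).obj V) f ha hb'
  · rintro ⟨⟨a⟩, ⟨b⟩⟩
    let I : ∀ V : SieveCat (H ⊓ K), (sep J F).obj (op ((incl inf_le_left).obj V)) ×
        (sep J G).obj (op ((incl inf_le_right).obj V)) → (sep J P).obj (op V) :=
      fun V => Function.surjInv (hb V).2
    have hI : ∀ V y, (((sepMap J inf_le_left φ).app (op V)).hom (I V y),
        ((sepMap J inf_le_right ψ).app (op V)).hom (I V y)) = y :=
      fun V => Function.surjInv_eq (hb V).2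
    let c : LocalSection J P U.unop :=
      { cov := a.cov ⊓ b.cov
        mem := J.intersection_covering a.mem b.mem
        le := fun V f hf => ⟨a.le _ hf.1, b.le _ hf.2⟩
        sec := fun V f hf => I V (a.sec (V := (incl inf_le_left).obj V) f hf.1,
          b.sec (V := (incl inf_le_right).obj V) f hf.2)
        compat := fun V W f hf g => by
          refine (hb W).1 (Eq.trans (Prod.ext ?_ ?_) (hI W _).symm)
          · refine (PresheafOfModules.naturality_apply (sepMap J inf_le_left φ) g.op _).trans ?_
            refine (congrArg ((sep J F).map ((incl inf_le_left).map g).op)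
              (Prod.ext_iff.1 (hI V _)).1).trans ?_
            exact a.compat (V := (incl inf_le_left).obj V) f hf.1 ((incl inf_le_left).map g)
          · refine (PresheafOfModules.naturality_apply (sepMap J inf_le_right ψ) g.op _).trans ?_
            refine (congrArg ((sep J G).map ((incl inf_le_right).map g).op)
              (Prod.ext_iff.1 (hI V _)).2).trans ?_
            exact b.compat (V := (incl inf_le_right).obj V) f hf.2 ((incl inf_le_right).map g) }
    refine ⟨Quotient.mk _ c, Prod.ext ?_ ?_⟩
    · exact Quotient.sound fun V f ha hb' => (Prod.ext_iff.1 (hI ⟨V.obj, _⟩ _)).1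
    · exact Quotient.sound fun V f ha hb' => (Prod.ext_iff.1 (hI ⟨V.obj, _⟩ _)).2

variable (R) in
/-- A standard vector bundle on `X`: a sieve `H` on `X` that belongs to the site, and an
`H`-presheaf `E` whose module of sections over each `Y → X` in `C_H` is a standard free module
`R(Y)^n` with `n = rank Y`, such that the map `ε : O_Y^n → f^*E` of presheaves on `C/Y` induced by the
standard basis of `E(Y)` is an isomorphism. On sections over `g : Z ⟶ Y` this map is
`(c_i) ↦ ∑ c_i g^*(e_i)`, and a map of presheaves of modules is an isomorphism if and only if it is
bijective on sections. -/
structure StandardBundle (X : C) where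
  sieve : Sieve X
  mem : sieve ∈ J X
  rank : SieveCat sieve → ℕ
  res : ∀ {Y Z : SieveCat sieve} (g : Z ⟶ Y),
    (Fin (rank Y) → R.obj (op Y.obj.left)) →ₛₗ[(R.map g.hom.left.op).hom]
      (Fin (rank Z) → R.obj (op Z.obj.left))
  res_id : ∀ (Y : SieveCat sieve) (a : Fin (rank Y) → R.obj (op Y.obj.left)), res (𝟙 Y) a = a
  res_comp : ∀ {Y Z W : SieveCat sieve} (g : Z ⟶ Y) (h : W ⟶ Z)
    (a : Fin (rank Y) → R.obj (op Y.obj.left)), res (h ≫ g) a = res h (res g a)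
  bijective : ∀ {Y Z : SieveCat sieve} (g : Z ⟶ Y),
    Function.Bijective fun c : Fin (rank Y) → R.obj (op Z.obj.left) =>
      ∑ i, c i • res g (Pi.single i 1)

namespace StandardBundle

variable {J}

/-- The underlying `H`-presheaf of a standard vector bundle; its sections over `Y` are
`Fin (rank Y) → R(Y)`. -/
noncomputable def presheaf (E : StandardBundle J R X) : HPresheaf.{w} R E.sieve :=
  mkPresheaf (R₀ := ringOn R E.sieve)
    (fun Y => ModuleCat.of (R.obj (op Y.unop.obj.left))
      (Fin (E.rank Y.unop) → R.obj (op Y.unop.obj.left)))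
    (fun g => E.res g.unop)
    (fun Y a => E.res_id Y.unop a)
    (fun g h a => E.res_comp g.unop h.unop a)

/-- The sheaf `ξ_H E` on the big site `C/X` associated with `(H, E)`. -/
noncomputable def sheaf (E : StandardBundle J R X) : PresheafOfModules.{max u₁ v w} (ringOver R X) :=
  sheafify J E.mem E.presheaf

/-- A morphism `(H, E) → (K, F)` is a morphism `ξ_H E → ξ_K F` of the associated sheaves (sheaves
being a full subcategory of presheaves of modules). -/
@[ext]
structure Hom (E F : StandardBundle J R X) where
  hom : E.sheaf ⟶ F.sheaf

noncomputable instance : Category (StandardBundle J R X) where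
  Hom := Hom
  id E := ⟨𝟙 E.sheaf⟩
  comp α β := ⟨α.hom ≫ β.hom⟩

@[simp]
theorem id_hom (E : StandardBundle J R X) : Hom.hom (𝟙 E) = 𝟙 E.sheaf := rfl

@[simp]
theorem comp_hom {E F G : StandardBundle J R X} (α : E ⟶ F) (β : F ⟶ G) :
    (α ≫ β).hom = α.hom ≫ β.hom := rfl

@[ext]
theorem hom_ext {E F : StandardBundle J R X} {α β : E ⟶ F} (h : α.hom = β.hom) : α = β :=
  Hom.ext h

variable (J R X) in
/-- The trivial standard vector bundle of rank `n`, on the largest sieve. -/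
noncomputable def trivial (n : ℕ) : StandardBundle J R X where
  sieve := ⊤
  mem := J.top_mem X
  rank _ := n
  res g :=
    { toFun := fun a i => (R.map g.hom.left.op).hom (a i)
      map_add' := fun a b => funext fun i => map_add _ _ _
      map_smul' := fun r a => funext fun i => map_mul _ _ _ }
  res_id Y a := by
    funext i
    simp
  res_comp g h a := by
    funext i
    simp
  bijective {Y Z} g := by
    convert Function.bijective_id
    rename_i c
    funext j
    simp [Finset.sum_apply, Pi.single_apply, apply_ite]

variable (J R X) in
/-- The zero bundle: the trivial bundle of rank `0`. -/
noncomputable def zero : StandardBundle J R X := trivial J R X 0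

/-- The direct sum of standard vector bundles: the presheaf direct sum on `H ∩ K`, whose values
`R(Y)^r × R(Y)^s` are identified with `R(Y)^(r + s)` by concatenation. -/
noncomputable def directSumObj (E F : StandardBundle J R X) : StandardBundle J R X where
  sieve := E.sieve ⊓ F.sieve
  mem := J.intersection_covering E.mem F.mem
  rank Y := E.rank ((incl inf_le_left).obj Y) + F.rank ((incl inf_le_right).obj Y)
  res g := blockSum (E.res ((incl inf_le_left).map g)) (F.res ((incl inf_le_right).map g))
  res_id Y a := blockSum_eq
    ((blockSum_left _ _ a).trans (E.res_id _ _)) ((blockSum_right _ _ a).trans (F.res_id _ _))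
  res_comp g h a := blockSum_eq
    ((blockSum_left _ _ a).trans ((E.res_comp ((incl inf_le_left).map g) ((incl inf_le_left).map h) _).trans
      ((congrArg _ (blockSum_left _ _ a).symm).trans (blockSum_left _ _ _).symm)))
    ((blockSum_right _ _ a).trans ((F.res_comp ((incl inf_le_right).map g) ((incl inf_le_right).map h) _).trans
      ((congrArg _ (blockSum_right _ _ a).symm).trans (blockSum_right _ _ _).symm)))
  bijective g := blockSum_bijective _ _
    (E.bijective ((incl inf_le_left).map g)) (F.bijective ((incl inf_le_right).map g))

/-- The projection `E ⊕ F → E|_{H ∩ K}` to the first `r` coordinates. -/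
noncomputable def projLeft (E F : StandardBundle J R X) :
    (directSumObj E F).presheaf ⟶ restrictPresheaf (inf_le_left : E.sieve ⊓ F.sieve ≤ E.sieve) E.presheaf :=
  mkHom (F := (directSumObj E F).presheaf) (G := restrictPresheaf inf_le_left E.presheaf)
    (fun _ =>
      { toFun := fun a i => a (Fin.castAdd _ i)
        map_add' := fun _ _ => rfl
        map_smul' := fun _ _ => rfl })
    (fun _ _ => funext fun i => Fin.append_left _ _ i)

/-- The projection `E ⊕ F → F|_{H ∩ K}` to the last `s` coordinates. -/
noncomputable def projRight (E F : StandardBundle J R X) :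
    (directSumObj E F).presheaf ⟶ restrictPresheaf (inf_le_right : E.sieve ⊓ F.sieve ≤ F.sieve) F.presheaf :=
  mkHom (F := (directSumObj E F).presheaf) (G := restrictPresheaf inf_le_right F.presheaf)
    (fun _ =>
      { toFun := fun a j => a (Fin.natAdd _ j)
        map_add' := fun _ _ => rfl
        map_smul' := fun _ _ => rfl })
    (fun _ _ => funext fun j => Fin.append_right _ _ j)

theorem proj_bijective (E F : StandardBundle J R X) (Y : (SieveCat (E.sieve ⊓ F.sieve))ᵒᵖ) :
    Function.Bijective fun s : (directSumObj E F).presheaf.obj Y =>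
      (((projLeft E F).app Y).hom s, ((projRight E F).app Y).hom s) :=
  (Fin.appendEquiv (α := R.obj (op Y.unop.obj.left)) _ _).symm.bijective

/-- The isomorphism `ω : ξ_{H ∩ K} (E ⊕ F) → ξ_H E ⊞ ξ_K F` induced by the isomorphism of `E ⊕ F` with
the presheaf direct sum. -/
noncomputable def sumComparison (E F : StandardBundle J R X) :
    (directSumObj E F).sheaf ⟶ presheafSum E.sheaf F.sheaf :=
  presheafSumLift (sheafifyMap J inf_le_left _ E.mem (projLeft E F)) (sheafifyMap J inf_le_right _ F.mem (projRight E F))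

instance (E F : StandardBundle J R X) : IsIso (sumComparison E F) :=
  isIso_presheafSumLift_sheafifyMap J _ E.mem F.mem (projLeft E F) (projRight E F) (proj_bijective E F)

/-- The direct sum `γ ⊕ δ = ω⁻¹ ∘ (γ ⊞ δ) ∘ ω` of two morphisms. -/
noncomputable def directSumMap {E E' F F' : StandardBundle J R X} (γ : E ⟶ E') (δ : F ⟶ F') :
    directSumObj E F ⟶ directSumObj E' F' :=
  ⟨sumComparison E F ≫ presheafSumMap γ.hom δ.hom ≫ inv (sumComparison E' F')⟩

variable (J R X) in
/-- The direct sum as a functor of two variables. -/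
noncomputable def directSum : StandardBundle J R X × StandardBundle J R X ⥤ StandardBundle J R X where
  obj P := directSumObj P.1 P.2
  map φ := directSumMap φ.1 φ.2
  map_id P := by
    apply hom_ext
    have : presheafSumMap (𝟙 P.1.sheaf) (𝟙 P.2.sheaf) = 𝟙 _ := by ext A x; all_goals rfl
    simp [directSumMap, this]
  map_comp φ ψ := by
    apply hom_ext
    have : presheafSumMap (φ.1.hom ≫ ψ.1.hom) (φ.2.hom ≫ ψ.2.hom) =
      presheafSumMap φ.1.hom φ.2.hom ≫ presheafSumMap ψ.1.hom ψ.2.hom := by rfl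
    simp [directSumMap, this]

/-- The pullback `(f^*H, f^*E)` of a standard vector bundle. -/
noncomputable def pullbackObj {Y : C} (f : Y ⟶ X) (E : StandardBundle J R X) : StandardBundle J R Y where
  sieve := E.sieve.pullback f
  mem := J.pullback_stable f E.mem
  rank V := E.rank ((push f E.sieve).obj V)
  res g := E.res ((push f E.sieve).map g)
  res_id V a := (congrArg (fun k => E.res k a) ((push f E.sieve).map_id V)).trans (E.res_id _ a)
  res_comp g h a := (congrArg (fun k => E.res k a) ((push f E.sieve).map_comp h g)).trans
    (E.res_comp _ _ a)
  bijective g := E.bijective ((push f E.sieve).map g)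

/-- The identification of `f^* ξ_H E` with `ξ_{f^*H} f^*E`. -/
noncomputable def pullbackIso {Y : C} (f : Y ⟶ X) (E : StandardBundle J R X) :
    pullbackOver f E.sheaf ≅ (pullbackObj f E).sheaf :=
  @asIso _ _ (pullbackOver f E.sheaf) (pullbackObj f E).sheaf (sheafifyPullbackHom J f E.mem E.presheaf)
    (isIso_sheafifyPullbackHom J f E.mem E.presheaf)

/-- The pullback of a morphism: `f^*α : f^* ξ_H E → f^* ξ_K F`, read as a morphism
`ξ_{f^*H} f^*E → ξ_{f^*K} f^*F`. -/
noncomputable def pullbackMap {Y : C} (f : Y ⟶ X) {E F : StandardBundle J R X} (α : E ⟶ F) :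
    pullbackObj f E ⟶ pullbackObj f F :=
  ⟨(pullbackIso f E).inv ≫ pullbackOverMap f α.hom ≫ (pullbackIso f F).hom⟩

variable (J R) in
/-- The pullback functor along `f : Y ⟶ X`. -/
noncomputable def pullback {Y : C} (f : Y ⟶ X) : StandardBundle J R X ⥤ StandardBundle J R Y where
  obj := pullbackObj f
  map := pullbackMap f
  map_id E := by
    apply hom_ext
    have : pullbackOverMap f (𝟙 E.sheaf) = 𝟙 _ := by ext A x; rfl
    simp [pullbackMap, this]
  map_comp α β := by
    apply hom_ext
    have : pullbackOverMap f (α.hom ≫ β.hom) = pullbackOverMap f α.hom ≫ pullbackOverMap f β.hom := rfl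
    simp [pullbackMap, this]

end StandardBundle

end Site
/-- A class of schemes that contains all open subschemes of its members. -/
def ContainsOpenSubschemes (P : ObjectProperty Scheme.{u}) : Prop :=
  ∀ X, P X → ∀ U : X.Opens, P U

/-- The big Zariski topology on the category `Sch` of the schemes in `P`: a sieve on `X` is covering
if it contains a family of open immersions `U_i → X` in `Sch` whose images cover `X`. -/
def bigZariski (P : ObjectProperty Scheme.{u}) (hP : ContainsOpenSubschemes P) :
    GrothendieckTopology P.FullSubcategory where
  sieves X := {S | ∀ x : X.obj, ∃ (U : P.FullSubcategory) (j : U ⟶ X),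
    S j ∧ IsOpenImmersion j.hom ∧ x ∈ Set.range j.hom}
  top_mem' X x := ⟨X, 𝟙 X, trivial, by simp; infer_instance, ⟨x, rfl⟩⟩
  pullback_stable' := by
    intro X Y S f hS y
    obtain ⟨U, j, hj, hjo, hy⟩ := hS (f.hom y)
    let W : Y.obj.Opens := f.hom ⁻¹ᵁ j.hom.opensRange
    let W' : P.FullSubcategory := ⟨W, hP _ Y.property W⟩
    let i : W' ⟶ Y := ObjectProperty.homMk W.ι
    refine ⟨W', i, ?_, inferInstanceAs (IsOpenImmersion W.ι), ⟨⟨y, hy⟩, rfl⟩⟩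
    let l : W' ⟶ U := ObjectProperty.homMk (IsOpenImmersion.lift j.hom (W.ι ≫ f.hom) (by
      rintro _ ⟨w, rfl⟩
      exact w.2))
    have hl : l ≫ j = i ≫ f := by
      ext1; exact IsOpenImmersion.lift_fac _ _ _
    change S (i ≫ f)
    rw [← hl]
    exact S.downward_closed hj l
  transitive' := by
    intro X S hS T hT x
    obtain ⟨U, j, hj, hjo, y, rfl⟩ := hS x
    obtain ⟨V, k, hk, hko, z, rfl⟩ := hT hj y
    exact ⟨V, k ≫ j, hk, inferInstanceAs (IsOpenImmersion (k.hom ≫ j.hom)), z, by simp⟩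

/-- The presheaf of rings `Y ↦ O_Y(Y)` on the category of the schemes in `P`. -/
noncomputable abbrev globalFunctions (P : ObjectProperty Scheme.{u}) :
    P.FullSubcategoryᵒᵖ ⥤ RingCat.{u} :=
  P.ι.op ⋙ Scheme.Γ ⋙ forget₂ CommRingCat RingCat

/-- The category of standard vector bundles on a scheme `X`, for the big Zariski site on the schemes
in `P`. -/
abbrev Bundle {P : ObjectProperty Scheme.{u}} (hP : ContainsOpenSubschemes P)
    (X : P.FullSubcategory) :=
  StandardBundle (bigZariski P hP) (globalFunctions P) X

namespace Bundle

variable {P : ObjectProperty Scheme.{u}} (hP : ContainsOpenSubschemes P)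

/-- The zero bundle on `X`. -/
noncomputable abbrev zero (X : P.FullSubcategory) : Bundle hP X :=
  StandardBundle.zero (bigZariski P hP) (globalFunctions P) X

/-- The direct sum functor on standard vector bundles on `X`. -/
noncomputable abbrev directSum (X : P.FullSubcategory) : Bundle hP X × Bundle hP X ⥤ Bundle hP X :=
  StandardBundle.directSum (bigZariski P hP) (globalFunctions P) X

/-- The pullback of standard vector bundles along a map of schemes `f : Y ⟶ X`. -/
noncomputable abbrev pullback {X Y : P.FullSubcategory} (f : Y ⟶ X) : Bundle hP X ⥤ Bundle hP Y :=
  StandardBundle.pullback (bigZariski P hP) (globalFunctions P) f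

end Bundle

end StdVB

namespace StdVB

universe w v u₁

/-! ### Concatenation of coordinates and block diagonal maps -/

section Block

variable {A B : Type*} [Ring A] [Ring B] {ρ : A →+* B} {r s t r' s' t' : ℕ}

/-! A standard vector bundle is concrete data: a sieve, a rank function, and restriction maps
between modules that are literally powers of the ring of functions. All of the strictness on objects
comes from this. Intersection of sieves is associative with the largest sieve as unit, addition of
ranks is associative with unit `0`, and block diagonal maps are associative with the empty block as
unit. Since `r + (s + t)` and `r + s + t` are equal without being the same expression, the
coordinates are compared through `Fin.cast`; `eq_of_rank_of_res` turns such a comparison into an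
equality of bundles. For pullback nothing has to be transported: both sides unfold to the same data.

On morphisms, equality of functors means compatibility with the morphisms `eqToHom` that come from
the equalities of objects. These are made explicit by `eqToHom_eq_ofPresheafMap`: each is the
sheafification of the relabelling of coordinates. The remaining argument is the universal one for
products. A morphism into `E ⊕ F` is determined by its composites with the two projections
(`directSum_hom_ext`), and `γ ⊕ δ` is compatible with the projections (`directSumMap_fst`,
`directSumMap_snd`). So it suffices that the relabellings and the pullback functor respect the
projections, and this is a comparison of indices: projections, relabellings and their composites all
come from presheaf maps that select coordinates. -/

theorem append_assoc_cast {A : Type*} (a : Fin r → A) (b : Fin s → A) (c : Fin t → A)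
    (h : r + (s + t) = r + s + t) :
    Fin.append (Fin.append a b) c ∘ Fin.cast h = Fin.append a (Fin.append b c) := by
  rw [Fin.append_assoc]
  rfl

/-- Both bracketings apply `α`, `β`, `γ` to the same three consecutive segments of `a` and
concatenate the results; only the bracketing of the index sets differs. -/
theorem blockSum_assoc (α : (Fin r → A) →ₛₗ[ρ] (Fin r' → B)) (β : (Fin s → A) →ₛₗ[ρ] (Fin s' → B))
    (γ : (Fin t → A) →ₛₗ[ρ] (Fin t' → B)) (a : Fin (r + s + t) → A) :
    blockSum (blockSum α β) γ a ∘ Fin.cast (Nat.add_assoc r' s' t').symm =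
      blockSum α (blockSum β γ) (a ∘ Fin.cast (Nat.add_assoc r s t).symm) := by
  refine (append_assoc_cast _ _ _ _).trans
    (congrArg (Fin.append _) (congrArg₂ Fin.append rfl (congrArg γ ?_)))
  -- Only the third segment needs an argument: it begins at `r + s` on one side and is reached by
  -- the shifts `r` and `s` on the other.
  exact funext fun i => congrArg a (Fin.ext (Nat.add_assoc _ _ _))

/-- The first block has no coordinates, so the last block is everything. A cast is needed because `0
+ s` does not reduce to `s`; with the zero block on the right, `r + 0` does reduce to `r`. -/
theorem zero_blockSum (α : (Fin 0 → A) →ₛₗ[ρ] (Fin 0 → B)) (β : (Fin s → A) →ₛₗ[ρ] (Fin s' → B))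
    (a : Fin (0 + s) → A) :
    blockSum α β a ∘ Fin.cast (Nat.zero_add s').symm = β (a ∘ Fin.cast (Nat.zero_add s).symm) := by
  have hcast : ∀ {n : ℕ} (i : Fin n), Fin.cast (Nat.zero_add n).symm i = Fin.natAdd 0 i :=
    fun _ => Fin.ext (Nat.zero_add _).symm
  refine Eq.trans (funext fun k => ?_) ((blockSum_right α β a).trans (congrArg β ?_))
  · exact congrArg (blockSum α β a) (hcast k)
  · exact funext fun j => congrArg a (hcast j).symm

end Block

/-! ### Equality of bundles, and morphisms induced by presheaf maps -/

section Site

variable {C : Type u₁} [Category.{v} C] {J : GrothendieckTopology C} {R : Cᵒᵖ ⥤ RingCat.{w}} {X : C}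

namespace StandardBundle

/-- Two standard vector bundles are equal when they have the same sieve, the same ranks, and the same
restriction maps up to the resulting identification of coordinates. -/
theorem eq_of_rank_of_res {E F : StandardBundle J R X} (hs : E.sieve = F.sieve)
    (hr : ∀ (V : Over X) (h : E.sieve V.hom) (h' : F.sieve V.hom), E.rank ⟨V, h⟩ = F.rank ⟨V, h'⟩)
    (hres : ∀ (V W : Over X) (g : W ⟶ V) (hV : E.sieve V.hom) (hV' : F.sieve V.hom)
      (hW : E.sieve W.hom) (hW' : F.sieve W.hom) (a : Fin (E.rank ⟨V, hV⟩) → R.obj (op V.left)),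
      E.res (Y := ⟨V, hV⟩) (Z := ⟨W, hW⟩) (ObjectProperty.homMk g) a ∘ Fin.cast (hr W hW hW').symm =
        F.res (Y := ⟨V, hV'⟩) (Z := ⟨W, hW'⟩) (ObjectProperty.homMk g)
          (a ∘ Fin.cast (hr V hV hV').symm)) :
    E = F := by
  obtain ⟨H, hH, r, ρ, _, _, _⟩ := E
  obtain ⟨K, hK, r', ρ', _, _, _⟩ := F
  dsimp only at hs hr hres
  subst hs
  -- With equal ranks the casts in `hres` are along reflexive equalities and disappear by
  -- definition, so `hres` is equality of the restriction maps. The other fields are proofs.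
  obtain rfl : r = r' := funext fun V => hr V.obj V.property V.property
  have : @ρ = @ρ' := by
    funext Y Z g
    exact LinearMap.ext fun a => hres Y.obj Z.obj g.hom Y.property Y.property Z.property Z.property a
  subst this
  rfl

theorem sieve_le_of_eq {E F : StandardBundle J R X} (h : E = F) : E.sieve ≤ F.sieve := by
  rw [h]

theorem rank_of_eq {E F : StandardBundle J R X} (h : E = F) (V : SieveCat E.sieve) :
    F.rank ((incl (sieve_le_of_eq h)).obj V) = E.rank V := by
  subst h; rfl

/-- The morphism of standard vector bundles induced by a map of the underlying presheaves. -/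
noncomputable def ofPresheafMap {E F : StandardBundle J R X} (hle : E.sieve ≤ F.sieve)
    (φ : E.presheaf ⟶ restrictPresheaf hle F.presheaf) : E ⟶ F :=
  ⟨sheafifyMap J hle E.mem F.mem φ⟩

/-- The composite of two maps of presheaves that live on decreasing sieves. -/
noncomputable def compPresheafMap {H K L : Sieve X} (hKH : K ≤ H) (hLK : L ≤ K) {P : HPresheaf.{w} R L}
    {Q : HPresheaf.{w} R K} {S : HPresheaf.{w} R H} (φ : P ⟶ restrictPresheaf hLK Q)
    (ψ : Q ⟶ restrictPresheaf hKH S) : P ⟶ restrictPresheaf (hLK.trans hKH) S :=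
  mkHom (F := P) (G := restrictPresheaf (hLK.trans hKH) S)
    (fun Y => (ψ.app (op ((incl hLK).obj Y.unop))).hom.comp (φ.app Y).hom)
    (fun g x => (congrArg (ψ.app _).hom (PresheafOfModules.naturality_apply φ g x)).trans
      (PresheafOfModules.naturality_apply ψ ((incl hLK).map g.unop).op _))

/-- Sheafification is functorial also when the sieves shrink: both sides keep the covering of a
representative and apply the two presheaf maps to its sections. -/
theorem ofPresheafMap_comp {E F G : StandardBundle J R X} (hEF : E.sieve ≤ F.sieve)
    (hFG : F.sieve ≤ G.sieve) (φ : E.presheaf ⟶ restrictPresheaf hEF F.presheaf)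
    (ψ : F.presheaf ⟶ restrictPresheaf hFG G.presheaf) :
    ofPresheafMap hEF φ ≫ ofPresheafMap hFG ψ =
      ofPresheafMap (hEF.trans hFG) (compPresheafMap hFG hEF φ ψ) := by
  apply hom_ext
  ext U x
  obtain ⟨a⟩ := x
  refine Quotient.sound fun V f ha _ => ?_
  change ((sepMap J hFG ψ).app _).hom (((sepMap J hEF φ).app _).hom
      (a.sec (V := ⟨V.obj, a.mem_of_cov f ha⟩) f ha)) =
    ((sepMap J (hEF.trans hFG) (compPresheafMap hFG hEF φ ψ)).app _).hom
      (a.sec (V := ⟨V.obj, a.mem_of_cov f ha⟩) f ha)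
  -- The sections lie in the separated presheaf, a quotient; on a representative in the presheaf
  -- itself the two sides agree by definition.
  generalize a.sec (V := ⟨V.obj, a.mem_of_cov f ha⟩) f ha = s
  obtain ⟨s, rfl⟩ := Submodule.Quotient.mk_surjective _ s
  rfl

theorem ofPresheafMap_congr {E F : StandardBundle J R X} {hle : E.sieve ≤ F.sieve}
    {φ ψ : E.presheaf ⟶ restrictPresheaf hle F.presheaf}
    (h : ∀ Y s, (φ.app Y).hom s = (ψ.app Y).hom s) : ofPresheafMap hle φ = ofPresheafMap hle ψ := by
  congr 1
  ext Y s
  exact h Y s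

/-- The identification of the presheaves of two equal bundles. -/
noncomputable def castPresheafMap {E F : StandardBundle J R X} (h : E = F) :
    E.presheaf ⟶ restrictPresheaf (sieve_le_of_eq h) F.presheaf :=
  mkHom (F := E.presheaf) (G := restrictPresheaf (sieve_le_of_eq h) F.presheaf)
    (fun Y =>
      { toFun := fun a i => a (Fin.cast (rank_of_eq h Y.unop) i)
        map_add' := fun _ _ => rfl
        map_smul' := fun _ _ => rfl })
    (fun _ _ => by subst h; rfl)

/-- This replaces an abstract transport by a relabelling of coordinates that can be composed with
projections. For the reflexive equality the relabelling is the identity, and so is the sheaf map it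
induces. -/
theorem eqToHom_eq_ofPresheafMap {E F : StandardBundle J R X} (h : E = F) :
    eqToHom h = ofPresheafMap (sieve_le_of_eq h) (castPresheafMap h) := by
  subst h
  apply hom_ext
  ext U x
  obtain ⟨a⟩ := x
  refine Quotient.sound fun V f ha _ => ?_
  change a.sec (V := ⟨V.obj, a.mem_of_cov f ha⟩) f ha = ((sepMap J _ (castPresheafMap rfl)).app _).hom
      (a.sec (V := ⟨V.obj, a.mem_of_cov f ha⟩) f ha)
  generalize a.sec (V := ⟨V.obj, a.mem_of_cov f ha⟩) f ha = s
  obtain ⟨s, rfl⟩ := Submodule.Quotient.mk_surjective _ s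
  rfl

/-! ### The projections of a direct sum -/

theorem directSumObj_sieve_le_left (E F : StandardBundle J R X) :
    (directSumObj E F).sieve ≤ E.sieve :=
  inf_le_left (a := E.sieve)

theorem directSumObj_sieve_le_right (E F : StandardBundle J R X) :
    (directSumObj E F).sieve ≤ F.sieve :=
  inf_le_right (b := F.sieve)

/-- The projection `E ⊕ F ⟶ E`. -/
noncomputable def fst (E F : StandardBundle J R X) : directSumObj E F ⟶ E :=
  ofPresheafMap (directSumObj_sieve_le_left E F) (projLeft E F)

/-- The projection `E ⊕ F ⟶ F`. -/
noncomputable def snd (E F : StandardBundle J R X) : directSumObj E F ⟶ F :=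
  ofPresheafMap (directSumObj_sieve_le_right E F) (projRight E F)

/-- The projections are the two components of `sumComparison E F`, which is an isomorphism and hence
can be cancelled. -/
theorem directSum_hom_ext {A E F : StandardBundle J R X} {α β : A ⟶ directSumObj E F}
    (h₁ : α ≫ fst E F = β ≫ fst E F) (h₂ : α ≫ snd E F = β ≫ snd E F) : α = β := by
  apply hom_ext
  rw [← cancel_mono (sumComparison E F)]
  ext U x
  exact Prod.ext
    (congrArg (fun k : A ⟶ E => (k.hom.app U).hom x) h₁)
    (congrArg (fun k : A ⟶ F => (k.hom.app U).hom x) h₂)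

theorem directSumMap_comparison {E E' F F' : StandardBundle J R X} (γ : E ⟶ E') (δ : F ⟶ F') :
    (directSumMap γ δ).hom ≫ sumComparison E' F' =
      sumComparison E F ≫ presheafSumMap γ.hom δ.hom := by
  simp [directSumMap]

/-- Since `γ ⊕ δ` is the conjugate of the objectwise sum by the comparison isomorphisms, naturality
of the projection is the first component of `directSumMap_comparison`. -/
theorem directSumMap_fst {E E' F F' : StandardBundle J R X} (γ : E ⟶ E') (δ : F ⟶ F') :
    directSumMap γ δ ≫ fst E' F' = fst E F ≫ γ := by
  apply hom_ext
  ext U x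
  exact congrArg (fun k : (directSumObj E F).sheaf ⟶ presheafSum E'.sheaf F'.sheaf =>
    ((k.app U).hom x).1) (directSumMap_comparison γ δ)

theorem directSumMap_snd {E E' F F' : StandardBundle J R X} (γ : E ⟶ E') (δ : F ⟶ F') :
    directSumMap γ δ ≫ snd E' F' = snd E F ≫ δ := by
  apply hom_ext
  ext U x
  exact congrArg (fun k : (directSumObj E F).sheaf ⟶ presheafSum E'.sheaf F'.sheaf =>
    ((k.app U).hom x).2) (directSumMap_comparison γ δ)

/-! ### Pullback of morphisms induced by presheaf maps -/

/-- The pullback of a map of presheaves on smaller sieves. -/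
noncomputable def pullbackPresheafMap {Y : C} (f : Y ⟶ X) {E F : StandardBundle J R X}
    (hle : E.sieve ≤ F.sieve) (φ : E.presheaf ⟶ restrictPresheaf hle F.presheaf) :
    (pullbackObj f E).presheaf ⟶ restrictPresheaf
      (show (pullbackObj f E).sieve ≤ (pullbackObj f F).sieve from fun _ _ h => hle _ h)
      (pullbackObj f F).presheaf :=
  mkHom (F := (pullbackObj f E).presheaf) (G := restrictPresheaf _ (pullbackObj f F).presheaf)
    (fun V => (φ.app (op ((push f E.sieve).obj V.unop))).hom)
    (fun g x => PresheafOfModules.naturality_apply φ ((push f E.sieve).map g.unop).op x)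

/-- The identification of `f^* ξ_H E` with `ξ_{f^*H} f^*E` leaves coverings and sections unchanged,
so it commutes with applying `φ` to the sections. This makes the pullbacks of the projections
computable. -/
theorem pullbackMap_ofPresheafMap {Y : C} (f : Y ⟶ X) {E F : StandardBundle J R X}
    (hle : E.sieve ≤ F.sieve) (φ : E.presheaf ⟶ restrictPresheaf hle F.presheaf) :
    pullbackMap f (ofPresheafMap hle φ) = ofPresheafMap
      (show (pullbackObj f E).sieve ≤ (pullbackObj f F).sieve from fun _ _ h => hle _ h)
      (pullbackPresheafMap f hle φ) := by
  apply hom_ext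
  -- Moving the inverse identification to the other side leaves only maps that are given by formulas
  -- on representatives.
  refine (Iso.inv_comp_eq _).2 ?_
  ext U x
  obtain ⟨a⟩ := x
  refine Quotient.sound fun V g ha _ => ?_
  change ((sepPullback J f F.presheaf).app (op _)).hom (((sepMap J hle φ).app _).hom
      (a.sec (V := ⟨(Over.map f).obj V.obj, _⟩) ((Over.map f).map g) ha)) =
    ((sepMap J _ (pullbackPresheafMap f hle φ)).app _).hom
      (((sepPullback J f E.presheaf).app (op ⟨V.obj, _⟩)).hom
        (a.sec (V := ⟨(Over.map f).obj V.obj, _⟩) ((Over.map f).map g) ha))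
  generalize a.sec (V := ⟨(Over.map f).obj V.obj, _⟩) ((Over.map f).map g) ha = s
  obtain ⟨s, rfl⟩ := Submodule.Quotient.mk_surjective _ s
  rfl

/-! ### Strict equalities on objects -/

theorem directSumObj_assoc (E F G : StandardBundle J R X) :
    directSumObj (directSumObj E F) G = directSumObj E (directSumObj F G) := by
  refine eq_of_rank_of_res (E := directSumObj (directSumObj E F) G)
    (F := directSumObj E (directSumObj F G)) (inf_assoc E.sieve F.sieve G.sieve)
    (fun V _ _ => Nat.add_assoc _ _ _) ?_
  intro V W g hV hV' hW hW' a
  exact blockSum_assoc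
    (E.res (Y := ⟨V, hV.1.1⟩) (Z := ⟨W, hW.1.1⟩) (ObjectProperty.homMk g))
    (F.res (Y := ⟨V, hV.1.2⟩) (Z := ⟨W, hW.1.2⟩) (ObjectProperty.homMk g))
    (G.res (Y := ⟨V, hV.2⟩) (Z := ⟨W, hW.2⟩) (ObjectProperty.homMk g)) a

theorem zero_directSumObj (E : StandardBundle J R X) : directSumObj (zero J R X) E = E := by
  refine eq_of_rank_of_res (E := directSumObj (zero J R X) E) (top_inf_eq E.sieve)
    (fun V _ _ => Nat.zero_add _) ?_
  intro V W g hV hV' hW hW' a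
  exact zero_blockSum ((zero J R X).res (Y := ⟨V, hV.1⟩) (Z := ⟨W, hW.1⟩) (ObjectProperty.homMk g))
    (E.res (Y := ⟨V, hV'⟩) (Z := ⟨W, hW'⟩) (ObjectProperty.homMk g)) a

theorem directSumObj_zero (E : StandardBundle J R X) : directSumObj E (zero J R X) = E := by
  refine eq_of_rank_of_res (E := directSumObj E (zero J R X)) (inf_top_eq E.sieve)
    (fun V _ _ => Nat.add_zero _) ?_
  intro V W g hV hV' hW hW' a
  funext k
  exact Fin.append_left _ _ k

theorem pullbackObj_zero {Y : C} (f : Y ⟶ X) : pullbackObj f (zero J R X) = zero J R Y := rfl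

/-- Membership in the sieve, ranks and restriction maps of a pullback are those of the original
evaluated at composites with `f`, and the direct sum is formed pointwise from the same data; hence
the two sides agree by definition. -/
theorem pullbackObj_directSumObj {Y : C} (f : Y ⟶ X) (E F : StandardBundle J R X) :
    pullbackObj f (directSumObj E F) = directSumObj (pullbackObj f E) (pullbackObj f F) := rfl

/-! ### The equalities of objects and pullback respect the projections -/

theorem eqToHom_assoc_fst (E F G : StandardBundle J R X) :
    eqToHom (directSumObj_assoc E F G) ≫ fst E (directSumObj F G) =
      fst (directSumObj E F) G ≫ fst E F := by
  rw [eqToHom_eq_ofPresheafMap, fst, fst, fst, ofPresheafMap_comp, ofPresheafMap_comp]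
  exact ofPresheafMap_congr fun _ _ => rfl

theorem eqToHom_assoc_snd_fst (E F G : StandardBundle J R X) :
    eqToHom (directSumObj_assoc E F G) ≫ snd E (directSumObj F G) ≫ fst F G =
      fst (directSumObj E F) G ≫ snd E F := by
  rw [eqToHom_eq_ofPresheafMap, fst, fst, snd, snd, ofPresheafMap_comp, ofPresheafMap_comp,
    ofPresheafMap_comp]
  exact ofPresheafMap_congr fun _ _ => rfl

/-- Of the three summands this is the one whose index is computed differently: `r + (s + i)` on one
side and `(r + s) + i` on the other. -/
theorem eqToHom_assoc_snd_snd (E F G : StandardBundle J R X) :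
    eqToHom (directSumObj_assoc E F G) ≫ snd E (directSumObj F G) ≫ snd F G =
      snd (directSumObj E F) G := by
  rw [eqToHom_eq_ofPresheafMap, snd, snd, snd, ofPresheafMap_comp, ofPresheafMap_comp]
  exact ofPresheafMap_congr fun _ s => funext fun i =>
    congrArg s (Fin.ext (Nat.add_assoc _ _ _).symm)

/-- The unit law on morphisms is reduced by this to naturality of a projection. -/
theorem eqToHom_zero_directSumObj (E : StandardBundle J R X) :
    eqToHom (zero_directSumObj E) = snd (zero J R X) E := by
  rw [eqToHom_eq_ofPresheafMap, snd]
  exact ofPresheafMap_congr fun _ s => funext fun i => congrArg s (Fin.ext (Nat.zero_add _).symm)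

theorem eqToHom_directSumObj_zero (E : StandardBundle J R X) :
    eqToHom (directSumObj_zero E) = fst E (zero J R X) := by
  rw [eqToHom_eq_ofPresheafMap, fst]
  exact ofPresheafMap_congr fun _ _ => rfl

theorem pullbackMap_fst {Y : C} (f : Y ⟶ X) (E F : StandardBundle J R X) :
    pullbackMap f (fst E F) = fst (pullbackObj f E) (pullbackObj f F) :=
  (pullbackMap_ofPresheafMap f _ _).trans (ofPresheafMap_congr fun _ _ => rfl)

theorem pullbackMap_snd {Y : C} (f : Y ⟶ X) (E F : StandardBundle J R X) :
    pullbackMap f (snd E F) = snd (pullbackObj f E) (pullbackObj f F) :=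
  (pullbackMap_ofPresheafMap f _ _).trans (ofPresheafMap_congr fun _ _ => rfl)

/-! ### Strict equalities on morphisms -/

theorem directSumMap_assoc {E E' F F' G G' : StandardBundle J R X} (γ : E ⟶ E') (δ : F ⟶ F')
    (ε : G ⟶ G') :
    directSumMap (directSumMap γ δ) ε ≫ eqToHom (directSumObj_assoc E' F' G') =
      eqToHom (directSumObj_assoc E F G) ≫ directSumMap γ (directSumMap δ ε) := by
  -- It suffices to compare the components in `E'`, `F'` and `G'`; there both sides become a
  -- projection followed by `γ`, `δ` or `ε`.
  refine directSum_hom_ext ?_ (directSum_hom_ext ?_ ?_)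
  · rw [Category.assoc, Category.assoc, eqToHom_assoc_fst, directSumMap_fst, ← Category.assoc,
      directSumMap_fst, Category.assoc, directSumMap_fst, ← Category.assoc, ← Category.assoc,
      eqToHom_assoc_fst]
  · simp only [Category.assoc]
    rw [eqToHom_assoc_snd_fst, ← Category.assoc, directSumMap_fst, Category.assoc,
      directSumMap_snd, ← Category.assoc (directSumMap γ _), directSumMap_snd, Category.assoc,
      directSumMap_fst]
    simp only [← Category.assoc]
    rw [← eqToHom_assoc_snd_fst]
    simp only [Category.assoc]
  · simp only [Category.assoc]
    rw [eqToHom_assoc_snd_snd, directSumMap_snd, ← Category.assoc (directSumMap γ _),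
      directSumMap_snd, Category.assoc, directSumMap_snd, ← eqToHom_assoc_snd_snd]
    simp only [Category.assoc]

theorem directSum_assoc :
    (directSum J R X).prod (𝟭 (StandardBundle J R X)) ⋙ directSum J R X =
      prod.associator (StandardBundle J R X) (StandardBundle J R X) (StandardBundle J R X) ⋙
        (𝟭 (StandardBundle J R X)).prod (directSum J R X) ⋙ directSum J R X := by
  refine CategoryTheory.Functor.ext (fun P => directSumObj_assoc P.1.1 P.1.2 P.2) fun P Q φ => ?_
  refine Eq.trans ?_ (Category.assoc _ _ _)
  -- Equality of functors asks for conjugation by `eqToHom`; this moves the one at the target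
  -- across, which leaves the commuting square.
  exact (comp_eqToHom_iff (directSumObj_assoc Q.1.1 Q.1.2 Q.2) _ _).1
    (directSumMap_assoc φ.1.1 φ.1.2 φ.2)

/-- Source and target are equal to those of `γ` only propositionally, hence the heterogeneous
equality. The square with `eqToHom` is naturality of the second projection, and composing with
`eqToHom` does not change a morphism up to `HEq`. -/
theorem directSumMap_id_zero_heq {E F : StandardBundle J R X} (γ : E ⟶ F) :
    HEq (directSumMap (𝟙 (zero J R X)) γ) γ := by
  have h : directSumMap (𝟙 (zero J R X)) γ ≫ eqToHom (zero_directSumObj F) =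
      eqToHom (zero_directSumObj E) ≫ γ := by
    simpa only [eqToHom_zero_directSumObj] using directSumMap_snd _ γ
  exact (comp_eqToHom_heq _ _).symm.trans ((heq_of_eq h).trans (eqToHom_comp_heq _ _))

theorem directSumMap_zero_id_heq {E F : StandardBundle J R X} (γ : E ⟶ F) :
    HEq (directSumMap γ (𝟙 (zero J R X))) γ := by
  have h : directSumMap γ (𝟙 (zero J R X)) ≫ eqToHom (directSumObj_zero F) =
      eqToHom (directSumObj_zero E) ≫ γ := by
    simpa only [eqToHom_directSumObj_zero] using directSumMap_fst γ _
  exact (comp_eqToHom_heq _ _).symm.trans ((heq_of_eq h).trans (eqToHom_comp_heq _ _))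

theorem pullbackMap_comp {Y : C} (f : Y ⟶ X) {E F G : StandardBundle J R X} (α : E ⟶ F)
    (β : F ⟶ G) : pullbackMap f (α ≫ β) = pullbackMap f α ≫ pullbackMap f β :=
  (pullback J R f).map_comp α β

/-- The two sides have a common source and target because the equality of objects is definitional.
Applying the functor `f^*` to the naturality squares of the projections, which it sends to
projections, shows that both have the same components. -/
theorem pullbackMap_directSumMap {Y : C} (f : Y ⟶ X) {E E' F F' : StandardBundle J R X}
    (γ : E ⟶ E') (δ : F ⟶ F') :
    pullbackMap f (directSumMap γ δ) = directSumMap (pullbackMap f γ) (pullbackMap f δ) := by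
  refine directSum_hom_ext (E := pullbackObj f E') (F := pullbackObj f F') ?_ ?_
  · refine Eq.trans ?_ (directSumMap_fst (pullbackMap f γ) (pullbackMap f δ)).symm
    rw [← pullbackMap_fst, ← pullbackMap_fst]
    exact (pullbackMap_comp f _ _).symm.trans
      ((congrArg (pullbackMap f) (directSumMap_fst γ δ)).trans (pullbackMap_comp f _ _))
  · refine Eq.trans ?_ (directSumMap_snd (pullbackMap f γ) (pullbackMap f δ)).symm
    rw [← pullbackMap_snd, ← pullbackMap_snd]
    exact (pullbackMap_comp f _ _).symm.trans
      ((congrArg (pullbackMap f) (directSumMap_snd γ δ)).trans (pullbackMap_comp f _ _))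

theorem directSum_comp_pullback {Y : C} (f : Y ⟶ X) :
    directSum J R X ⋙ pullback J R f =
      (pullback J R f).prod (pullback J R f) ⋙ directSum J R Y := by
  refine CategoryTheory.Functor.ext (fun P => pullbackObj_directSumObj f P.1 P.2) fun P Q φ => ?_
  -- The equalities of objects hold by definition, so the two `eqToHom` are identities.
  exact (pullbackMap_directSumMap f φ.1 φ.2).trans
    ((Category.id_comp _).trans (Category.comp_id _)).symm

end StandardBundle

end Site

end StdVB

theorem theorem3p5 (P : ObjectProperty Scheme.{u}) (hP : StdVB.ContainsOpenSubschemes P)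
    (X : P.FullSubcategory) :
    -- strict associativity, as an equality of functors
    ((StdVB.Bundle.directSum hP X).prod (𝟭 (StdVB.Bundle hP X)) ⋙ StdVB.Bundle.directSum hP X =
      prod.associator (StdVB.Bundle hP X) (StdVB.Bundle hP X) (StdVB.Bundle hP X) ⋙
        (𝟭 (StdVB.Bundle hP X)).prod (StdVB.Bundle.directSum hP X) ⋙
          StdVB.Bundle.directSum hP X) ∧
    -- the zero bundle is a strict unit, on objects and on morphisms
    ((∀ E : StdVB.Bundle hP X,
        (StdVB.Bundle.directSum hP X).obj (StdVB.Bundle.zero hP X, E) = E ∧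
        (StdVB.Bundle.directSum hP X).obj (E, StdVB.Bundle.zero hP X) = E) ∧
      ∀ (E F : StdVB.Bundle hP X) (γ : E ⟶ F),
        HEq ((StdVB.Bundle.directSum hP X).map (Prod.mkHom (𝟙 (StdVB.Bundle.zero hP X)) γ)) γ ∧
        HEq ((StdVB.Bundle.directSum hP X).map (Prod.mkHom γ (𝟙 (StdVB.Bundle.zero hP X)))) γ) ∧
    -- pullback strictly preserves the zero bundle and the direct sum
    ∀ (Y : P.FullSubcategory) (f : Y ⟶ X),
      (StdVB.Bundle.pullback hP f).obj (StdVB.Bundle.zero hP X) = StdVB.Bundle.zero hP Y ∧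
      StdVB.Bundle.directSum hP X ⋙ StdVB.Bundle.pullback hP f =
        (StdVB.Bundle.pullback hP f).prod (StdVB.Bundle.pullback hP f) ⋙
          StdVB.Bundle.directSum hP Y := by
  open StdVB.StandardBundle in
  exact ⟨directSum_assoc,
    ⟨fun E => ⟨zero_directSumObj E, directSumObj_zero E⟩,
      fun _ _ γ => ⟨directSumMap_id_zero_heq γ, directSumMap_zero_id_heq γ⟩⟩,
    fun _ f => ⟨pullbackObj_zero f, directSum_comp_pullback f⟩⟩
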